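/- Let $G$ be a finite solvable group and let $\chi\in\operatorname{Irr}(G)$ be an irreducible complex character with $\chi(1)>1$. Write $[\varphi,\psi]=\frac1{|G|}\sum_{g\in G}\varphi(g)\overline{\psi(g)}$ and $\operatorname{Ker}(\alpha)=\{g\in G:\alpha(g)=\alpha(1)\}$. Let $\{\alpha_1,\dots,\alpha_n\}$ be the set of non-principal irreducible constituents of the character $\chi\overline{\chi}$, that is, of all $\alpha\in\operatorname{Irr}(G)$ with $\alpha\neq 1_G$ and $[\chi\overline{\chi},\alpha]\neq 0$. If $\operatorname{Ker}(\alpha_j)$ is maximal under inclusion among the subgroups $\operatorname{Ker}(\alpha_i)$, $i=1,\dots,n$, then $[\chi\overline{\chi},\alpha_j]=1$. Thus $1\in\{[\chi\overline{\chi},\alpha_i]\mid i=1,\dots,n\}$. -/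

import Mathlib

open scoped ComplexOrder ComplexConjugate

namespace FinGroupChar

/-- `Irr G`: the set of irreducible complex characters of `G`, that is, of the functions
`g ↦ trace (ρ g)` for `ρ` an irreducible finite-dimensional complex representation of `G`.
(Spaces in `Type` suffice, see `character_mem_Irr`.) -/
def Irr (G : Type*) [Group G] : Set (G → ℂ) :=
  {χ | ∃ (V : Type) (_ : AddCommGroup V) (_ : Module ℂ V) (_ : FiniteDimensional ℂ V)
    (ρ : Representation ℂ G V), ρ.IsIrreducible ∧ ρ.character = χ}

/-- The inner product `[φ, ψ] = |G|⁻¹ ∑ g, φ g * conj (ψ g)` of complex functions on `G`.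
For a character `φ` and `ψ ∈ Irr G` it is the multiplicity of `ψ` in `φ`. -/
noncomputable def charInner {G : Type*} [Fintype G] (φ ψ : G → ℂ) : ℂ :=
  (Fintype.card G : ℂ)⁻¹ * ∑ g : G, φ g * conj (ψ g)

/-- The kernel `{g | χ g = χ 1}` of a character `χ`. -/
def charKer {G : Type*} [Group G] (χ : G → ℂ) : Set G :=
  {g | χ g = χ 1}

/-- The product `χ χ̄`. -/
noncomputable def mulConj {G : Type*} (χ : G → ℂ) : G → ℂ :=
  fun g => χ g * conj (χ g)

/-- The set of non-principal irreducible constituents of a character `φ` of `G`; the principal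
character `1_G` is the constant function `1`. -/
def nonprincipalConstituents {G : Type*} [Group G] [Fintype G] (φ : G → ℂ) : Set (G → ℂ) :=
  {α | α ∈ Irr G ∧ α ≠ 1 ∧ charInner φ α ≠ 0}

/-- The definition of `Irr G` does not depend on the universe of the representation spaces. -/
theorem character_mem_Irr {G V : Type*} [Group G] [AddCommGroup V] [Module ℂ V]
    [FiniteDimensional ℂ V] (ρ : Representation ℂ G V) (hρ : ρ.IsIrreducible) :
    ρ.character ∈ Irr G := by
  let e : V ≃ₗ[ℂ] (Fin (Module.finrank ℂ V) → ℂ) := (Module.finBasis ℂ V).equivFun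
  let σ : Representation ℂ G (Fin (Module.finrank ℂ V) → ℂ) :=
    { toFun := fun g => e.conj (ρ g)
      map_one' := by simp [LinearEquiv.conj_id, Module.End.one_eq_id]
      map_mul' := fun g h => by simp [Module.End.mul_eq_comp, LinearEquiv.conj_comp] }
  have hσ : ∀ g v, σ g (e v) = e (ρ g v) := fun g v => by
    change e.conj (ρ g) (e v) = _
    simp [LinearEquiv.conj_apply]
  refine ⟨_, _, _, inferInstance, σ, ?_, ?_⟩
  · let E : Subrepresentation σ ≃o Subrepresentation ρ :=
      { toFun := fun W => ⟨W.toSubmodule.comap e.toLinearMap, fun g v hv => by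
          have := W.apply_mem_toSubmodule g hv
          simpa [hσ] using this⟩
        invFun := fun W => ⟨W.toSubmodule.map e.toLinearMap, fun g v hv => by
          obtain ⟨w, hw, rfl⟩ := hv
          exact ⟨ρ g w, W.apply_mem_toSubmodule g hw, (hσ g w).symm⟩⟩
        left_inv := fun W => by
          apply Subrepresentation.toSubmodule_injective
          exact Submodule.map_comap_eq_of_surjective e.surjective _
        right_inv := fun W => by
          apply Subrepresentation.toSubmodule_injective
          exact Submodule.comap_map_eq_of_injective e.injective _
        map_rel_iff' := by
          intro W W'
          exact Submodule.comap_le_comap_iff_of_surjective (f := e.toLinearMap) e.surjective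
            (p := W.toSubmodule) (q := W'.toSubmodule) }
    exact E.isSimpleOrder_iff.mpr hρ
  · ext g
    exact LinearMap.trace_conj' (ρ g) e

end FinGroupChar

/-!
Let `V` afford `χ`. Then `χ χ̄` is the character of `End V`, with `G` acting by conjugation, and
`[χ χ̄, α]` is the dimension of `Hom_G(W, End V)` when `W` affords `α` (`charInner_mulConj`).

For a normal subgroup `M` the `M`-fixed points of `End V` are the operators commuting with `M`. If
`V` is reducible over `M` they are not all scalars, and they then contain a nonprincipal
constituent of `χ χ̄` with `M` in its kernel (`exists_nonprincipalConstituent`). Taking `M = 1` shows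
that nonprincipal constituents exist when `χ 1 > 1`.

Suppose now that the kernel `N` of `α` is maximal among the kernels of the nonprincipal
constituents. As `G` is solvable, there is a normal subgroup `L > N` with `L / N` abelian
(`exists_normal_lt_commutator_le`). By maximality no nonprincipal constituent has `L` in its
kernel, so `V` is irreducible over `L`. On the other hand `L` acts on `W` through the abelian group
`L / N`, so `W` contains a common eigenvector `w` of `L` (`exists_forall_apply_eq_smul`). A `G`-map
`f : W → End V` is determined by the operator `f w`, on which `L` acts by a fixed linear character.
Such operators form at most a line: each nonzero one is invertible, since its kernel is `L`-stable,
and over `ℂ` a space of operators whose nonzero members are invertible has dimension at most one.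
Hence the multiplicity is at most one (`finrank_intertwiningMap_le_one`).

That `charKer χ` is the kernel of the representation, and that `χ g⁻¹` is the conjugate of `χ g`,
follow from the existence of an invariant inner product (`exists_unitary`).
-/

namespace FinGroupChar

open Module Representation

/-! ### Unitarity and character kernels -/

section Unitary

variable {G V : Type*} [Group G] [Fintype G] [AddCommGroup V] [Module ℂ V] [FiniteDimensional ℂ V]

open scoped MatrixOrder Matrix.Norms.L2Operator in
/-- Weyl's unitary trick, for a single group element: in a basis that is orthonormal for a
`G`-invariant inner product, `ρ g` has a unitary matrix. -/
theorem exists_unitary (ρ : Representation ℂ G V) (g : G) :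
    ∃ U ∈ Matrix.unitaryGroup (Fin (finrank ℂ V)) ℂ, ρ.character g = U.trace ∧
      ρ.character g⁻¹ = (star U).trace ∧ (U = 1 → ρ g = 1) := by
  classical
  let b := Module.finBasis ℂ V
  let A : G → Matrix (Fin (finrank ℂ V)) (Fin (finrank ℂ V)) ℂ := fun g =>
    LinearMap.toMatrix b b (ρ g)
  have hmul : ∀ g h, A (g * h) = A g * A h := fun g h => by
    simp only [A, map_mul, LinearMap.toMatrix_mul]
  have hone : A 1 = 1 := by simp only [A, map_one, LinearMap.toMatrix_one]
  have htr : ∀ g, ρ.character g = (A g).trace := fun g =>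
    LinearMap.trace_eq_matrix_trace ℂ b (ρ g)
  -- The Gram matrix of the average of the standard inner product over `G`.
  let H := ∑ g, star (A g) * A g
  have hH : H.PosDef := by
    have : H = star (A 1) * A 1 + ∑ g ∈ Finset.univ.erase 1, star (A g) * A g :=
      (Finset.add_sum_erase _ _ (Finset.mem_univ _)).symm
    rw [this, hone]
    refine Matrix.PosDef.add_posSemidef (by simpa using Matrix.PosDef.one) ?_
    exact Matrix.posSemidef_sum _ fun g _ => Matrix.posSemidef_conjTranspose_mul_self _
  have hinv : star (A g) * H * A g = H := by
    simp only [H, Finset.mul_sum, Finset.sum_mul]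
    refine Fintype.sum_equiv (Equiv.mulRight g) _ _ fun h => ?_
    simp [hmul, mul_assoc]
  obtain ⟨C, hC, hHC⟩ : ∃ C, IsUnit C ∧ H = star C * C :=
    CStarAlgebra.isStrictlyPositive_iff_eq_star_mul_self.mp hH.isStrictlyPositive
  obtain ⟨u, rfl⟩ := hC
  have hUU : star (u.val * A g * u⁻¹.val) * (u.val * A g * u⁻¹.val) = 1 := by
    calc _ = star u⁻¹.val * (star (A g) * (star u.val * u.val) * A g) * u⁻¹.val := by
          simp only [star_mul, mul_assoc]
      _ = star (u.val * u⁻¹.val) * (u.val * u⁻¹.val) := by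
          rw [← hHC, hinv, hHC]; simp only [star_mul, mul_assoc]
      _ = 1 := by simp
  have hAA : A g * A g⁻¹ = 1 := by rw [← hmul, mul_inv_cancel, hone]
  have hU' : (u.val * A g * u⁻¹.val) * (u.val * A g⁻¹ * u⁻¹.val) = 1 := by
    calc _ = u.val * (A g * A g⁻¹) * u⁻¹.val := by simp [mul_assoc]
      _ = 1 := by simp [hAA]
  refine ⟨u.val * A g * u⁻¹.val, Matrix.mem_unitaryGroup_iff'.mpr hUU, ?_, ?_, fun h => ?_⟩
  · rw [htr, Matrix.trace_units_conj]
  · rw [left_inv_eq_right_inv hUU hU', htr, Matrix.trace_units_conj]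
  · have h1 : A g = 1 := by
      have := congrArg (fun X => u⁻¹.val * X * u.val) h
      simpa [mul_assoc] using this
    exact (LinearMap.toMatrix b b).injective (h1.trans (LinearMap.toMatrix_one b).symm)

theorem character_inv (ρ : Representation ℂ G V) (g : G) :
    ρ.character g⁻¹ = conj (ρ.character g) := by
  obtain ⟨U, -, h, h', -⟩ := exists_unitary ρ g
  rw [h, h', Matrix.star_eq_conjTranspose, Matrix.trace_conjTranspose, starRingEnd_apply]

/-- The character kernel is the kernel of the representation. For a unitary matrix `U` of size `n`
with trace `n`, the squared Hilbert–Schmidt norm of `U - 1` is `2 n - 2 Re (tr U) = 0`. -/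
theorem mem_charKer_character (ρ : Representation ℂ G V) {g : G} :
    g ∈ charKer ρ.character ↔ ρ g = 1 := by
  refine ⟨fun hg => ?_, fun hg => by simp [charKer, character, hg]⟩
  obtain ⟨U, hU, h, h', h1⟩ := exists_unitary ρ g
  refine h1 (sub_eq_zero.mp (Matrix.trace_conjTranspose_mul_self_eq_zero_iff.mp ?_))
  have hg' : ρ.character g = finrank ℂ V := by rw [← char_one ρ]; exact hg
  have hUtr : U.trace = finrank ℂ V := h.symm.trans hg'
  have hU'tr : (star U).trace = finrank ℂ V := by
    rw [← h', character_inv, hg', map_natCast]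
  rw [← Matrix.star_eq_conjTranspose, star_sub, star_one, sub_mul, mul_sub, mul_sub,
    Matrix.mem_unitaryGroup_iff'.mp hU]
  simp [hUtr, hU'tr]

end Unitary

/-! ### Multiplicities in the endomorphism representation -/

section Multiplicity

variable {G V W : Type*} [Group G] [AddCommGroup V] [Module ℂ V]
  [FiniteDimensional ℂ V] [AddCommGroup W] [Module ℂ W] [FiniteDimensional ℂ W]

/-- The multiplicity of `σ` in `χ χ̄` is the dimension of the space of `G`-maps from `σ` to
`End V`, where `V` affords `χ`. -/
theorem charInner_mulConj [Fintype G] (ρ : Representation ℂ G V) (σ : Representation ℂ G W) :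
    charInner (mulConj ρ.character) σ.character = finrank ℂ (IntertwiningMap σ (linHom ρ ρ)) := by
  let : Invertible (Nat.card G : ℂ) := invertibleOfNonzero (by simp)
  rw [← card_inv_mul_sum_char_mul_char_eq_finrank, charInner, Nat.card_eq_fintype_card]
  simp only [char_linHom, character_inv, mulConj, mul_comm]

/-- Schur's lemma, for an operator given as a plain linear map. -/
theorem exists_eq_smul_of_commute (ρ : Representation ℂ G V) [ρ.IsIrreducible] (T : V →ₗ[ℂ] V)
    (hT : ∀ g v, T (ρ g v) = ρ g (T v)) : ∃ c : ℂ, ∀ v, T v = c • v := by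
  let f : IntertwiningMap ρ ρ := T.intertwiningMap_of_isIntertwiningMap ρ ρ hT
  obtain ⟨c, hc⟩ := IsIrreducible.algebraMap_intertwiningMap_bijective_of_isAlgClosed.2 f
  exact ⟨c, fun v => (DFunLike.congr_fun hc v).symm⟩

theorem exists_isIrreducible_toRepresentation_le {ρ : Representation ℂ G V}
    {F : Subrepresentation ρ} (hF : F.toSubmodule ≠ ⊥) :
    ∃ S ≤ F, S.toRepresentation.IsIrreducible := by
  have hmono : StrictMono (Subrepresentation.toSubmodule (ρ := ρ)) := fun _ _ h => h
  have := hmono.wellFoundedLT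
  obtain ⟨S, hS, hSF⟩ := (eq_bot_or_exists_atom_le F).resolve_left fun h =>
    hF (congrArg Subrepresentation.toSubmodule h)
  have hSne : S.toSubmodule ≠ ⊥ := fun h => hS.1 (Subrepresentation.toSubmodule_injective h)
  refine ⟨S, hSF, { exists_pair_ne := ⟨⊥, ⊤, fun h => ?_⟩, eq_bot_or_eq_top := fun T => ?_ }⟩
  · have := (Submodule.nontrivial_iff_ne_bot).mpr hSne
    exact bot_ne_top (α := Submodule ℂ S.toSubmodule) (congrArg Subrepresentation.toSubmodule h)
  · let T' : Subrepresentation ρ := ⟨T.toSubmodule.map S.toSubmodule.subtype, by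
      rintro g _ ⟨v, hv, rfl⟩
      exact ⟨_, T.apply_mem_toSubmodule g hv, rfl⟩⟩
    have hT' : T' ≤ S := Submodule.map_subtype_le _ _
    rcases hS.le_iff.mp hT' with h | h
    · refine Or.inl (Subrepresentation.toSubmodule_injective ?_)
      apply Submodule.map_injective_of_injective S.toSubmodule.injective_subtype
      exact (congrArg Subrepresentation.toSubmodule h).trans (Submodule.map_bot _).symm
    · refine Or.inr (Subrepresentation.toSubmodule_injective ?_)
      apply Submodule.map_injective_of_injective S.toSubmodule.injective_subtype
      exact (congrArg Subrepresentation.toSubmodule h).trans (Submodule.map_subtype_top _).symm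

/-- The restriction of a representation to a subgroup. -/
abbrev res (ρ : Representation ℂ G V) (L : Subgroup G) : Representation ℂ L V := ρ.comp L.subtype

omit [FiniteDimensional ℂ V] in
/-- An operator on `V` that spans a line stable under conjugation by `L`, where `V` is
irreducible over `L`, is zero or injective, because its kernel is `L`-stable. -/
theorem eq_zero_or_injective (ρ : Representation ℂ G V) {L : Subgroup G} [(res ρ L).IsIrreducible]
    (T : V →ₗ[ℂ] V) (hT : ∀ l ∈ L, ∃ c : ℂ, linHom ρ ρ l T = c • T) :
    T = 0 ∨ LinearMap.ker T = ⊥ := by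
  let K : Subrepresentation (res ρ L) := ⟨LinearMap.ker T, fun l v hv => by
    obtain ⟨c, hc⟩ := hT l⁻¹ (inv_mem l.2)
    have h := congrArg (ρ l) (LinearMap.congr_fun hc v)
    simpa [linHom_apply, LinearMap.mem_ker.mp hv] using h⟩
  rcases eq_bot_or_eq_top K with h | h
  · exact Or.inr (congrArg Subrepresentation.toSubmodule h)
  · exact Or.inl (LinearMap.ker_eq_top.mp (congrArg Subrepresentation.toSubmodule h))

omit [FiniteDimensional ℂ W] in
/-- If `V` is irreducible over `L`, an irreducible representation `W` containing an
`L`-eigenvector `w` has multiplicity at most one in `End V`: a `G`-map `f` is determined by `f w`,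
and the `L`-eigenvectors of a given weight in `End V` form at most a line. -/
theorem finrank_intertwiningMap_le_one (ρ : Representation ℂ G V) (σ : Representation ℂ G W)
    [σ.IsIrreducible] {L : Subgroup G} [(res ρ L).IsIrreducible] {w : W} (hw : w ≠ 0)
    (hwL : ∀ l ∈ L, ∃ c : ℂ, σ l w = c • w) :
    finrank ℂ (IntertwiningMap σ (linHom ρ ρ)) ≤ 1 := by
  have hzero : ∀ f : IntertwiningMap σ (linHom ρ ρ), f w = 0 → f = 0 := fun f hf =>
    (IsIrreducible.injective_or_eq_zero f).resolve_left fun h => hw (h (by simpa using hf))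
  have hinj : ∀ f : IntertwiningMap σ (linHom ρ ρ), f = 0 ∨ LinearMap.ker (f w) = ⊥ := fun f =>
    (eq_zero_or_injective ρ (f w) fun l hl => by
      obtain ⟨c, hc⟩ := hwL l hl
      exact ⟨c, by rw [← f.isIntertwining, hc, map_smul]⟩).imp_left (hzero f)
  rcases subsingleton_or_nontrivial (IntertwiningMap σ (linHom ρ ρ)) with _ | _
  · exact finrank_zero_of_subsingleton.trans_le zero_le_one
  obtain ⟨f, hf⟩ := exists_ne (0 : IntertwiningMap σ (linHom ρ ρ))
  have hfw := (hinj f).resolve_left hf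
  have : Nontrivial V := by
    by_contra h
    rw [not_nontrivial_iff_subsingleton] at h
    exact hf (hzero f (Subsingleton.elim _ _))
  let e := LinearEquiv.ofInjectiveEndo (f w) (LinearMap.ker_eq_bot.mp hfw)
  refine finrank_le_one f fun h => ?_
  -- Subtracting an eigenvalue of `(f w)⁻¹ ∘ h w` times `f` from `h` produces a singular operator.
  obtain ⟨c, hc⟩ := Module.End.exists_eigenvalue (e.symm.toLinearMap ∘ₗ h w)
  obtain ⟨v, hv⟩ := hc.exists_hasEigenvector
  refine ⟨c, (sub_eq_zero.mp ((hinj (h - c • f)).resolve_right fun hk => hv.2 ?_)).symm⟩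
  have h1 : e.symm (h w v) = c • v := hv.apply_eq_smul
  have h2 : h w v = c • f w v := by
    rw [LinearEquiv.symm_apply_eq, map_smul] at h1
    exact h1
  rw [← Submodule.mem_bot ℂ, ← hk, LinearMap.mem_ker]
  simp [h2]

/-! ### Constituents with a normal subgroup in their kernel -/

omit [FiniteDimensional ℂ V] in
theorem nontrivial_of_isIrreducible (ρ : Representation ℂ G V) [ρ.IsIrreducible] : Nontrivial V := by
  by_contra h
  rw [not_nontrivial_iff_subsingleton] at h
  exact bot_ne_top (α := Subrepresentation ρ)
    (Subrepresentation.toSubmodule_injective (Subsingleton.elim _ _))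

/-- An irreducible representation with trivial action has the principal character. -/
theorem character_eq_one_of_forall_eq_one (σ : Representation ℂ G W) [σ.IsIrreducible]
    (h : ∀ g, σ g = 1) : σ.character = 1 := by
  have := nontrivial_of_isIrreducible σ
  obtain ⟨w, hw⟩ := exists_ne (0 : W)
  let S : Subrepresentation σ := ⟨Submodule.span ℂ {w}, fun g v hv => by simpa [h g] using hv⟩
  have hS : Submodule.span ℂ {w} = ⊤ := by
    refine congrArg Subrepresentation.toSubmodule ((eq_bot_or_eq_top S).resolve_left fun h0 => hw ?_)
    exact Submodule.span_singleton_eq_bot.mp (congrArg Subrepresentation.toSubmodule h0)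
  ext g
  have hd : finrank ℂ W = 1 := by rw [← finrank_top, ← hS, finrank_span_singleton hw]
  simp [character, h g, hd]

/-- If `V` is reducible over the normal subgroup `M`, then `χ χ̄` has a nonprincipal constituent
with `M` in its kernel. The operators commuting with `M` form a `G`-submodule of `End V` which
contains the projections onto `M`-submodules, hence nonscalar operators. Its trace-zero part is
therefore nonzero, and the trivial representation does not occur there because the
`G`-invariant operators are scalars. -/
theorem exists_nonprincipalConstituent [Fintype G] (ρ : Representation ℂ G V) [ρ.IsIrreducible]
    (M : Subgroup G) [M.Normal] (hM : ¬ (res ρ M).IsIrreducible) :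
    ∃ β ∈ nonprincipalConstituents (mulConj ρ.character), (M : Set G) ⊆ charKer β := by
  have := nontrivial_of_isIrreducible ρ
  have hn : (finrank ℂ V : ℂ) ≠ 0 := by exact_mod_cast (finrank_pos (R := ℂ) (M := V)).ne'
  let F : Subrepresentation (linHom ρ ρ) :=
    { toSubmodule := invariants ((linHom ρ ρ).comp M.subtype) ⊓ LinearMap.ker (LinearMap.trace ℂ V)
      apply_mem_toSubmodule := fun g T hT => by
        refine ⟨le_comap_invariants (linHom ρ ρ) M g hT.1, ?_⟩
        have h : LinearMap.trace ℂ V T = 0 := hT.2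
        change LinearMap.trace ℂ V (linHom ρ ρ g T) = 0
        rw [linHom_apply, LinearMap.trace_comp_comm', LinearMap.comp_assoc,
          ← Module.End.mul_eq_comp (ρ g⁻¹), ← map_mul, inv_mul_cancel, map_one,
          Module.End.one_eq_id, LinearMap.comp_id, h] }
  have hF : F.toSubmodule ≠ ⊥ := by
    obtain ⟨U, hU0, hU1⟩ : ∃ U : Subrepresentation (res ρ M), U ≠ ⊥ ∧ U ≠ ⊤ := by
      by_contra! h
      refine hM { exists_pair_ne := ⟨⊥, ⊤, fun h => ?_⟩, eq_bot_or_eq_top := fun U => ?_ }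
      · exact bot_ne_top (α := Submodule ℂ V) (congrArg Subrepresentation.toSubmodule h)
      · exact or_iff_not_imp_left.mpr (h U)
    have : NeZero (Nat.card M : ℂ) := ⟨by exact_mod_cast Nat.card_pos.ne'⟩
    obtain ⟨U', hUU'⟩ := exists_isCompl U
    have hc : IsCompl U.toSubmodule U'.toSubmodule :=
      IsCompl.of_eq (congrArg Subrepresentation.toSubmodule hUU'.inf_eq_bot)
        (congrArg Subrepresentation.toSubmodule hUU'.sup_eq_top)
    -- The projection onto `U` along an `M`-stable complement commutes with `M`.
    let P : V →ₗ[ℂ] V := Submodule.projection U.toSubmodule U'.toSubmodule hc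
    have hPM : ∀ m ∈ M, linHom ρ ρ m P = P := fun m hm => by
      have hPm : ∀ v, P (ρ m v) = ρ m (P v) := fun v => by
        obtain ⟨a, ha, b, hb, rfl⟩ : ∃ a ∈ U.toSubmodule, ∃ b ∈ U'.toSubmodule, a + b = v :=
          Submodule.mem_sup.mp (hc.sup_eq_top ▸ Submodule.mem_top)
        have ha' : ρ m a ∈ U.toSubmodule := U.apply_mem_toSubmodule ⟨m, hm⟩ ha
        have hb' : ρ m b ∈ U'.toSubmodule := U'.apply_mem_toSubmodule ⟨m, hm⟩ hb
        simp only [map_add, P, Submodule.projection_apply_left hc ⟨a, ha⟩,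
          Submodule.projection_apply_left hc ⟨_, ha'⟩,
          (Submodule.projection_apply_eq_zero_iff hc).mpr hb,
          (Submodule.projection_apply_eq_zero_iff hc).mpr hb', map_zero]
      ext v
      simp [linHom_apply, ← hPm]
    -- Subtracting the scalar `c` makes the trace vanish.
    let c : ℂ := (finrank ℂ V : ℂ)⁻¹ * LinearMap.trace ℂ V P
    have hmem : P - c • LinearMap.id ∈ F.toSubmodule := by
      refine ⟨fun m => ?_, ?_⟩
      · have := hPM m m.2
        have hid : linHom ρ ρ (m : G) LinearMap.id = LinearMap.id := by
          ext v; simp [linHom_apply]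
        change linHom ρ ρ (m : G) (P - c • LinearMap.id) = _
        rw [map_sub, map_smul, this, hid]
      · change LinearMap.trace ℂ V _ = 0
        simp only [map_sub, map_smul, LinearMap.trace_id, smul_eq_mul, c]
        field_simp
        ring
    intro h0
    rw [h0, Submodule.mem_bot] at hmem
    have hP : ∀ v, P v = c • v := fun v => sub_eq_zero.mp (LinearMap.congr_fun hmem v)
    have hU0' : U.toSubmodule ≠ ⊥ := fun h => hU0 (Subrepresentation.toSubmodule_injective h)
    have hU1' : U'.toSubmodule ≠ ⊥ := fun h => hU1 <| Subrepresentation.toSubmodule_injective <| by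
      have := hc.sup_eq_top
      rwa [h, sup_bot_eq] at this
    -- A scalar operator cannot act as `1` on `U ≠ 0` and as `0` on `U' ≠ 0`.
    obtain ⟨u, hu, hu0⟩ := Submodule.exists_mem_ne_zero_of_ne_bot hU0'
    obtain ⟨u', hu', hu0'⟩ := Submodule.exists_mem_ne_zero_of_ne_bot hU1'
    have h1 : c • u' = 0 := by
      rw [← hP]; exact (Submodule.projection_apply_eq_zero_iff hc).mpr hu'
    have h2 : c • u = u := by
      rw [← hP]; exact Submodule.projection_apply_left hc ⟨u, hu⟩
    rw [(smul_eq_zero.mp h1).resolve_right hu0', zero_smul] at h2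
    exact hu0 h2.symm
  obtain ⟨S, hSF, hS⟩ := exists_isIrreducible_toRepresentation_le hF
  let τ : Representation ℂ G S.toSubmodule := S.toRepresentation
  let f : IntertwiningMap τ (linHom ρ ρ) :=
    { toLinearMap := S.toSubmodule.subtype
      isIntertwining' := fun g => rfl }
  have hfinj : Function.Injective f := Subtype.val_injective
  have := nontrivial_of_isIrreducible τ
  obtain ⟨s, hs⟩ := exists_ne (0 : S.toSubmodule)
  have hfs : f s ≠ 0 := fun h => hs (hfinj (h.trans (map_zero f).symm))
  refine ⟨τ.character, ⟨character_mem_Irr τ hS, fun h1 => hfs ?_, ?_⟩, fun m hm => ?_⟩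
  · have hτ : ∀ g, τ g = 1 := fun g =>
      (mem_charKer_character τ).mp ((congrFun h1 g).trans (congrFun h1 1).symm)
    obtain ⟨c, hc⟩ := exists_eq_smul_of_commute ρ (f s) fun g v => by
      have h := LinearMap.congr_fun (IntertwiningMap.isIntertwining _ _ f g s) (ρ g v)
      simpa [linHom_apply, hτ] using h
    have hfc : f s = c • LinearMap.id := LinearMap.ext hc
    have htr : LinearMap.trace ℂ V (f s) = 0 := (hSF s.2).2
    rw [hfc] at htr ⊢
    simp only [map_smul, LinearMap.trace_id, smul_eq_mul, mul_eq_zero, hn, or_false] at htr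
    rw [htr, zero_smul]
  · have : Nontrivial (IntertwiningMap τ (linHom ρ ρ)) :=
      ⟨f, 0, fun h => hfs (by rw [h]; rfl)⟩
    rw [charInner_mulConj]
    exact_mod_cast (finrank_pos (R := ℂ) (M := IntertwiningMap τ (linHom ρ ρ))).ne'
  · rw [mem_charKer_character]
    ext s : 1
    exact hfinj ((IntertwiningMap.isIntertwining _ _ f m s).trans ((hSF s.2).1 ⟨m, hm⟩))

end Multiplicity

/-! ### Abelian normal sections and their eigenvectors -/

/-- In a solvable group, above any proper normal subgroup `N` lies a normal subgroup `L`
with `L / N` abelian and nontrivial: pull back the last nontrivial term of the derived series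
of `G / N`. -/
theorem exists_normal_lt_commutator_le {G : Type*} [Group G] [Group.IsSolvable G] (N : Subgroup G)
    [N.Normal] (hN : N ≠ ⊤) : ∃ L : Subgroup G, L.Normal ∧ N < L ∧ ⁅L, L⁆ ≤ N := by
  classical
  have hex : ∃ k, derivedSeries (G ⧸ N) k = ⊥ := Group.IsSolvable.solvable
  obtain ⟨k, hk⟩ : ∃ k, Nat.find hex = k + 1 := Nat.exists_eq_succ_of_ne_zero fun h => hN <| by
    have h0 := Nat.find_spec hex
    rw [h, derivedSeries_zero] at h0
    rw [← QuotientGroup.ker_mk' N, ← MonoidHom.comap_bot, ← h0, Subgroup.comap_top]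
  have hne : derivedSeries (G ⧸ N) k ≠ ⊥ := Nat.find_min hex (by omega)
  have hbot : ⁅derivedSeries (G ⧸ N) k, derivedSeries (G ⧸ N) k⁆ = ⊥ := by
    rw [← derivedSeries_succ, ← hk]; exact Nat.find_spec hex
  have hker : (⊥ : Subgroup (G ⧸ N)).comap (QuotientGroup.mk' N) = N := by
    rw [MonoidHom.comap_bot, QuotientGroup.ker_mk']
  have hsurj := QuotientGroup.mk'_surjective N
  have := derivedSeries_normal (G ⧸ N) k
  refine ⟨(derivedSeries (G ⧸ N) k).comap (QuotientGroup.mk' N), inferInstance, ?_, ?_⟩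
  · conv_lhs => rw [← hker]
    exact (Subgroup.comap_lt_comap_of_surjective hsurj).mpr (bot_lt_iff_ne_bot.mpr hne)
  · refine le_of_le_of_eq (Subgroup.map_le_iff_le_comap.mp ?_) hker
    rw [Subgroup.map_commutator, Subgroup.map_comap_eq_self_of_surjective hsurj, hbot]

/-- If `σ` kills the commutators of `L`, then `L` acts on `W` by commuting operators and so has
a common eigenvector: `L` acts by scalars on any irreducible `L`-submodule, by Schur's lemma. -/
theorem exists_forall_apply_eq_smul {G W : Type*} [Group G] [AddCommGroup W] [Module ℂ W]
    [FiniteDimensional ℂ W] [Nontrivial W] (σ : Representation ℂ G W) (L : Subgroup G)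
    (hL : ⁅L, L⁆ ≤ MonoidHom.ker σ) : ∃ w : W, w ≠ 0 ∧ ∀ l ∈ L, ∃ c : ℂ, σ l w = c • w := by
  have hcomm : ∀ a ∈ L, ∀ b ∈ L, σ (a * b) = σ (b * a) := fun a ha b hb => by
    have h : σ (a * b * a⁻¹ * b⁻¹) = 1 := hL (Subgroup.commutator_mem_commutator ha hb)
    calc σ (a * b) = σ (a * b * a⁻¹ * b⁻¹) * σ (b * a) := by rw [← map_mul]; group
      _ = σ (b * a) := by rw [h, one_mul]
  obtain ⟨S, -, hS⟩ := exists_isIrreducible_toRepresentation_le (ρ := res σ L) (F := ⊤)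
    (top_ne_bot (α := Submodule ℂ W))
  let τ : Representation ℂ L S.toSubmodule := S.toRepresentation
  have := nontrivial_of_isIrreducible τ
  obtain ⟨w, hw⟩ := exists_ne (0 : S.toSubmodule)
  refine ⟨w, fun h => hw (Subtype.ext h), fun l hl => ?_⟩
  obtain ⟨c, hc⟩ := exists_eq_smul_of_commute τ (τ ⟨l, hl⟩) fun g v => by
    rw [← Module.End.mul_apply, ← Module.End.mul_apply, ← map_mul, ← map_mul]
    exact Subtype.ext (LinearMap.congr_fun (hcomm l hl g g.2) (v : W))
  exact ⟨c, congrArg Subtype.val (hc w)⟩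

end FinGroupChar

/-! ### Constituents with maximal kernel -/

open FinGroupChar Representation in
theorem theoremC {G : Type*} [Group G] [Fintype G] [Group.IsSolvable G]
    (χ : G → ℂ) (hχ : χ ∈ FinGroupChar.Irr G) (hχ1 : 1 < χ 1) :
    (∀ α : G → ℂ,
      MaximalFor (fun β => β ∈ FinGroupChar.nonprincipalConstituents (FinGroupChar.mulConj χ))
        FinGroupChar.charKer α →
      FinGroupChar.charInner (FinGroupChar.mulConj χ) α = 1) ∧
    ∃ α ∈ FinGroupChar.nonprincipalConstituents (FinGroupChar.mulConj χ),
      FinGroupChar.charInner (FinGroupChar.mulConj χ) α = 1 := by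
  obtain ⟨V, _, _, _, ρ, hρ, rfl⟩ := hχ
  have key : ∀ α : G → ℂ, MaximalFor (fun β => β ∈ nonprincipalConstituents (mulConj ρ.character))
      charKer α → charInner (mulConj ρ.character) α = 1 := by
    rintro _ ⟨⟨⟨W, _, _, _, σ, hσ, rfl⟩, hα1, hα0⟩, hmax⟩
    have hker : ∀ g, g ∈ charKer σ.character ↔ g ∈ MonoidHom.ker σ := fun g =>
      mem_charKer_character σ
    have hN : MonoidHom.ker σ ≠ ⊤ := fun h =>
      hα1 (character_eq_one_of_forall_eq_one σ fun g => h.ge (Subgroup.mem_top g))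
    obtain ⟨L, hLn, hNL, hL⟩ := exists_normal_lt_commutator_le (MonoidHom.ker σ) hN
    -- By maximality of the kernel, no nonprincipal constituent has `L` in its kernel.
    have hirr : (res ρ L).IsIrreducible := by
      by_contra h
      obtain ⟨β, hβ, hLβ⟩ := exists_nonprincipalConstituent ρ L h
      have hαβ : charKer σ.character ⊆ charKer β := fun g hg => hLβ (hNL.le ((hker g).mp hg))
      exact hNL.not_ge fun g hg => (hker g).mp (hmax hβ hαβ (hLβ hg))
    have := nontrivial_of_isIrreducible σ
    obtain ⟨w, hw, hwL⟩ := exists_forall_apply_eq_smul σ L hL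
    have hle := finrank_intertwiningMap_le_one ρ σ hw hwL
    rw [charInner_mulConj] at hα0 ⊢
    exact_mod_cast le_antisymm hle (Nat.one_le_iff_ne_zero.mpr (by exact_mod_cast hα0))
  refine ⟨key, ?_⟩
  -- Since `χ 1 > 1`, the restriction to the trivial subgroup is reducible.
  have hbot : ¬ (res ρ (⊥ : Subgroup G)).IsIrreducible := fun h => by
    have h1 := congrFun (character_eq_one_of_forall_eq_one (res ρ (⊥ : Subgroup G)) fun g => by
      rw [Subsingleton.elim g 1, map_one]) 1
    rw [char_one] at h1 hχ1
    exact hχ1.ne' h1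
  obtain ⟨β, hβ, -⟩ := exists_nonprincipalConstituent ρ ⊥ hbot
  obtain ⟨α, hα⟩ := Set.Finite.exists_maximalFor' charKer
    (nonprincipalConstituents (mulConj ρ.character)) (Set.toFinite _) ⟨β, hβ⟩
  exact ⟨α, hα.prop, key α hα⟩
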